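/- Let $(W,S)$ be an arbitrary Coxeter system with length function $\ell$. A subset $I\subset S$ is called finitary if the subgroup $W_I=\langle I\rangle$ is finite; then $w_I$ denotes the longest element of $W_I$. For finitary $I,J\subset S$, an $(I,J)$-coset is an element $p$ of $W_I\backslash W/W_J$; write $\overline p$ and $\underline p$ for its unique elements of maximal and of minimal length. For $x,y\in W$ let $x*y$ be the product in the Coxeter monoid, that is, the associative product on $W$ with unit $1$ determined by $s*x=sx$ if $\ell(sx)>\ell(x)$ and $s*x=x$ otherwise, for $s\in S$, $x\in W$. For an $(I,J)$-coset $p$ and a $(J,K)$-coset $q$ put $p*q=W_I(\overline p*\overline q)W_K$, and call $p*q$ reduced if $\overline p*\overline q=(\overline p w_J^{-1})\,\overline q=\overline p\,(w_J^{-1}\overline q)$ and $\ell(\overline p*\overline q)=\ell(\overline p w_J^{-1})+\ell(\overline q)=\ell(\overline p)+\ell(w_J^{-1}\overline q)$. The nilCoxeter algebroid $\mathcal D=\mathcal D(W,S)$ is the $\mathbb Z$-linear category whose objects are the finitary subsets of $S$, in which $\operatorname{Hom}(J,I)$ is the free $\mathbb Z$-module with basis $\{\partial_p\}$, $p$ running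 over the $(I,J)$-cosets, and whose composition is the bilinear one with $\partial_p\circ\partial_q=\partial_{p*q}$ if $p*q$ is reduced and $\partial_p\circ\partial_q=0$ otherwise. The identity of $I$ is $\partial_p$ for the $(I,I)$-coset $p$ containing $1$. An $(I,J)$-coset $p$ is a core coset if $I\cap \underline p J\underline p^{-1}=I$ and $\underline p^{-1}I\underline p\cap J=J$. It is atomic if it is a core coset and there are $s\in S\setminus I$ and $t\in S\setminus J$ such that $K:=I\cup\{s\}=J\cup\{t\}$ is finitary and $\overline p=w_K$ (that is, $[I,K,J]$ is a reduced expression for $p$). Let $\mathcal{AD}\subset\mathcal D$ be the $\mathbb Z$-linear subcategory, with all objects of $\mathcal D$, generated by the morphisms $\partial_p$ for $p$ an atomic coset. **Theorem.** For all finitary $I,J\subset S$, the $\mathbb Z$-module $\operatorname{Hom}_{\mathcal{AD}}(J,I)$ is free with basis $\{\partial_p \mid p \text{ a core } (I,J)\text{-coset}\}$. -/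

import Mathlib

open CategoryTheory

namespace CoxeterSystem

variable {B W : Type*} [Group W] {M : CoxeterMatrix B} (cs : CoxeterSystem M W)

/-! ### The exchange property -/

open Classical in
/-- Auxiliary involution of `W × ZMod 2`, used for the exchange property. -/
noncomputable def signFun (i : B) : Function.End (W × ZMod 2) := fun x =>
  (cs.simple i * x.1 * cs.simple i, x.2 + if x.1 = cs.simple i then 1 else 0)

open Classical in
theorem signFun_pow (i j : B) (k : ℕ) (x : W × ZMod 2) :
    ((cs.signFun i * cs.signFun j) ^ k) x =
      ((cs.simple i * cs.simple j) ^ k * x.1 * ((cs.simple i * cs.simple j) ^ k)⁻¹,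
        x.2 + ∑ n ∈ Finset.range (2 * k),
          if x.1 = cs.simple j * (cs.simple i * cs.simple j) ^ n then 1 else 0) := by
  induction k with
  | zero => simp; rfl
  | succ k ih =>
    have hinv : ∀ n : ℕ, ((cs.simple i * cs.simple j) ^ n)⁻¹ * cs.simple j
        = cs.simple j * (cs.simple i * cs.simple j) ^ n := by
      intro n
      have h : SemiconjBy (cs.simple j) (cs.simple i * cs.simple j)
          (cs.simple i * cs.simple j)⁻¹ := by
        simp [SemiconjBy, mul_assoc]
      rw [← inv_pow]
      exact (h.pow_right n).symm
    rw [pow_succ']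
    change (cs.signFun i * cs.signFun j) (((cs.signFun i * cs.signFun j) ^ k) x) = _
    rw [ih]
    change cs.signFun i (cs.signFun j _) = _
    set c := cs.simple i * cs.simple j with hc
    have e1 : (c ^ k * x.1 * (c ^ k)⁻¹ = cs.simple j) ↔ x.1 = cs.simple j * c ^ (2 * k) := by
      rw [mul_inv_eq_iff_eq_mul, ← eq_inv_mul_iff_mul_eq, ← mul_assoc, hinv, mul_assoc, ← pow_add,
        two_mul]
    have e2 : (cs.simple j * (c ^ k * x.1 * (c ^ k)⁻¹) * cs.simple j = cs.simple i) ↔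
        x.1 = cs.simple j * c ^ (2 * k + 1) := by
      have : cs.simple j * (c ^ k * x.1 * (c ^ k)⁻¹) * cs.simple j = cs.simple i ↔
          c ^ k * x.1 * (c ^ k)⁻¹ = cs.simple j * c := by
        generalize c ^ k * x.1 * (c ^ k)⁻¹ = y
        rw [hc]
        constructor
        · intro h
          rw [← h]; simp [mul_assoc]
        · intro h
          rw [h]; simp [mul_assoc]
      rw [this, mul_inv_eq_iff_eq_mul, ← eq_inv_mul_iff_mul_eq, ← mul_assoc, ← mul_assoc, hinv,
        mul_assoc, mul_assoc, ← pow_succ', ← pow_add]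
      ring_nf
    ext
    · simp [signFun, hc, pow_succ', mul_assoc]
    · simp only [signFun, e1, e2]
      rw [show 2 * (k + 1) = 2 * k + 1 + 1 by ring, Finset.sum_range_succ, Finset.sum_range_succ]
      ring

theorem signFun_isLiftable : M.IsLiftable cs.signFun := by
  classical
  intro i j
  funext x
  rw [signFun_pow, two_mul, Finset.sum_range_add]
  simp only [pow_add, simple_mul_simple_pow, one_mul]
  ext
  · simp; rfl
  · simp [CharTwo.add_self_eq_zero]; rfl

open Classical in
theorem lift_signFun_wordProd (ω : List B) (x : W × ZMod 2) :
    cs.lift ⟨cs.signFun, cs.signFun_isLiftable⟩ (cs.wordProd ω) x =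
      (cs.wordProd ω * x.1 * (cs.wordProd ω)⁻¹,
        x.2 + ((cs.rightInvSeq ω).count x.1 : ℕ)) := by
  induction ω with
  | nil => simp; rfl
  | cons i ω ih =>
    rw [wordProd_cons, map_mul, lift_apply_simple]
    change cs.signFun i _ = _
    rw [ih, rightInvSeq, List.count_cons]
    have : (cs.wordProd ω * x.1 * (cs.wordProd ω)⁻¹ = cs.simple i) ↔
        (cs.wordProd ω)⁻¹ * cs.simple i * cs.wordProd ω = x.1 := by
      rw [mul_inv_eq_iff_eq_mul, ← eq_inv_mul_iff_mul_eq, eq_comm, mul_assoc]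
    ext
    · simp [signFun, mul_assoc]
    · simp only [signFun, this, beq_iff_eq]
      push_cast
      ring

theorem exchange_right (ω : List B) (i : B)
    (h : cs.length (cs.wordProd ω * cs.simple i) < cs.length (cs.wordProd ω)) :
    ∃ j < ω.length, cs.wordProd ω * cs.simple i = cs.wordProd (ω.eraseIdx j) := by
  classical
  obtain ⟨ω', hω', hw⟩ := cs.exists_isReduced (cs.wordProd ω * cs.simple i)
  have hp : cs.wordProd (ω' ++ [i]) = cs.wordProd ω := by
    rw [wordProd_append, ← hw]; simp
  have hr : cs.IsReduced (ω' ++ [i]) := by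
    unfold IsReduced
    rw [hp]
    have := (cs.isRightDescent_iff).1 h
    rw [hw, hω'.eq] at this
    simp [← this]
  have hmem : cs.simple i ∈ cs.rightInvSeq (ω' ++ [i]) := by
    rw [← List.concat_eq_append, rightInvSeq_concat]; simp
  have hc : (cs.rightInvSeq (ω' ++ [i])).count (cs.simple i) = 1 :=
    List.count_eq_one_of_mem hr.nodup_rightInvSeq hmem
  have h1 := cs.lift_signFun_wordProd (ω' ++ [i]) (cs.simple i, 0)
  rw [hp, lift_signFun_wordProd, hc] at h1
  have h2 : (((cs.rightInvSeq ω).count (cs.simple i) : ℕ) : ZMod 2) = 1 := by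
    simpa using congrArg Prod.snd h1
  have hmem' : cs.simple i ∈ cs.rightInvSeq ω := by
    by_contra hn
    rw [List.count_eq_zero_of_not_mem hn] at h2
    simp at h2
  obtain ⟨j, hj, hji⟩ := List.getElem_of_mem hmem'
  refine ⟨j, by simpa using hj, ?_⟩
  rw [← wordProd_mul_getD_rightInvSeq, List.getD_eq_getElem _ _ hj, hji]

theorem exists_reduced_subset (ω : List B) :
    ∃ ω' : List B, ω' ⊆ ω ∧ cs.IsReduced ω' ∧ cs.wordProd ω' = cs.wordProd ω := by
  induction ω using List.reverseRecOn with
  | nil => exact ⟨[], by simp, by simp [IsReduced], rfl⟩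
  | append_singleton ω i ih =>
    obtain ⟨ω', h1, h2, h3⟩ := ih
    rcases cs.length_mul_simple (cs.wordProd ω') i with h | h
    · refine ⟨ω' ++ [i], ?_, ?_, ?_⟩
      · simp only [List.append_subset, List.subset_append_right, and_true]
        exact fun x hx => List.mem_append_left _ (h1 hx)
      · simp [IsReduced, wordProd_append, h, h2.eq]
      · simp [wordProd_append, h3]
    · obtain ⟨j, hj, he⟩ := cs.exchange_right ω' i (by omega)
      refine ⟨ω'.eraseIdx j, ?_, ?_, ?_⟩
      · exact fun x hx => List.mem_append_left _ (h1 (List.mem_of_mem_eraseIdx hx))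
      · have := List.length_eraseIdx_of_lt hj
        have h4 := h2.eq
        unfold IsReduced
        rw [← he]; omega
      · rw [← he, wordProd_append, h3]; simp

/-! ### The Coxeter monoid -/

/-- The operator `x ↦ s * x` of the Coxeter monoid, for a simple reflection `s`: it is `sx` if
`ℓ(sx) > ℓ(x)`, and `x` otherwise. -/
noncomputable def leftStar (s x : W) : W := if cs.length x < cs.length (s * x) then s * x else x

/-- The mirror image of `leftStar`. -/
noncomputable def rightStar (x s : W) : W := if cs.length x < cs.length (x * s) then x * s else x

/-- The product of the Coxeter monoid (0-Hecke monoid, star monoid) `(W, *)`, transported to `W`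
along the identification by reduced expressions: if `s₁ ⋯ sₖ` is a reduced expression of `x` then
`x * y = s₁ * (s₂ * (⋯ (sₖ * y)))`. It does not depend on the reduced expression, by
`star_eq_foldr`. -/
noncomputable def star (x y : W) : W :=
  (cs.exists_isReduced x).choose.foldr (fun i z => cs.leftStar (cs.simple i) z) y

theorem leftStar_rightStar (i j : B) (w : W) :
    cs.leftStar (cs.simple i) (cs.rightStar w (cs.simple j)) =
      cs.rightStar (cs.leftStar (cs.simple i) w) (cs.simple j) := by
  have key : cs.length w < cs.length (cs.simple i * w) →
      cs.length w < cs.length (w * cs.simple j) →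
      cs.length (cs.simple i * w * cs.simple j) < cs.length (cs.simple i * w) →
      cs.simple i * w = w * cs.simple j := by
    intro h1 h2 h3
    obtain ⟨ω, hω, rfl⟩ := cs.exists_isReduced w
    obtain ⟨k, hk, he⟩ := cs.exchange_right (i :: ω) j (by simpa [wordProd_cons] using h3)
    cases k with
    | zero =>
      rw [wordProd_cons] at he
      simp only [List.eraseIdx_zero, List.tail_cons] at he
      generalize cs.wordProd ω = w at he
      nth_rewrite 2 [← he]
      simp [mul_assoc]
    | succ k =>
      exfalso
      simp only [List.eraseIdx_cons_succ, wordProd_cons, mul_assoc, mul_right_inj] at he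
      have h4 := cs.length_wordProd_le (ω.eraseIdx k)
      have h5 := List.length_eraseIdx_of_lt (l := ω) (i := k) (by simpa using hk)
      rw [← he] at h4
      have := hω.eq
      simp at hk
      omega
  have a1 := cs.length_simple_mul w i
  have a2 := cs.length_mul_simple w j
  have a3 := cs.length_mul_simple (cs.simple i * w) j
  have a4 := cs.length_simple_mul (w * cs.simple j) i
  rw [← mul_assoc] at a4
  unfold leftStar rightStar
  split_ifs <;> simp only [mul_assoc] at * <;> first
    | rfl
    | (exfalso; omega)
    | exact (key (by omega) (by omega) (by omega)).symm

theorem foldr_rightStar (ω : List B) (j : B) (w : W) :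
    ω.foldr (fun i z => cs.leftStar (cs.simple i) z) (cs.rightStar w (cs.simple j)) =
      cs.rightStar (ω.foldr (fun i z => cs.leftStar (cs.simple i) z) w) (cs.simple j) := by
  induction ω with
  | nil => rfl
  | cons i ω ih => simp only [List.foldr_cons, ih, leftStar_rightStar]

theorem foldr_foldl (ω ω' : List B) (w : W) :
    ω.foldr (fun i z => cs.leftStar (cs.simple i) z)
        (ω'.foldl (fun z i => cs.rightStar z (cs.simple i)) w) =
      ω'.foldl (fun z i => cs.rightStar z (cs.simple i))
        (ω.foldr (fun i z => cs.leftStar (cs.simple i) z) w) := by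
  induction ω' generalizing w with
  | nil => rfl
  | cons i ω' ih => simp only [List.foldl_cons, ih, foldr_rightStar]

theorem foldr_one {ω : List B} (h : cs.IsReduced ω) :
    ω.foldr (fun i z => cs.leftStar (cs.simple i) z) 1 = cs.wordProd ω := by
  induction ω with
  | nil => simp
  | cons i ω ih =>
    have h' : cs.IsReduced ω := by simpa using h.drop 1
    rw [List.foldr_cons, ih h', wordProd_cons, leftStar, if_pos]
    have := h.eq
    rw [wordProd_cons, List.length_cons] at this
    rw [this, h'.eq]; omega

theorem foldl_one {ω : List B} (h : cs.IsReduced ω) :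
    ω.foldl (fun z i => cs.rightStar z (cs.simple i)) 1 = cs.wordProd ω := by
  induction ω using List.reverseRecOn with
  | nil => simp
  | append_singleton ω i ih =>
    have h' : cs.IsReduced ω := by simpa using h.take ω.length
    rw [List.foldl_append, ih h', wordProd_append]
    simp only [List.foldl_cons, List.foldl_nil, wordProd_singleton]
    rw [rightStar, if_pos]
    have := h.eq
    rw [wordProd_append, List.length_append, wordProd_singleton] at this
    rw [this, h'.eq]; simp

/-- The star product may be computed by any word whose star product is `x`. -/
theorem star_foldr (ω : List B) (y : W) :
    cs.star (ω.foldr (fun i z => cs.leftStar (cs.simple i) z) 1) y =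
      ω.foldr (fun i z => cs.leftStar (cs.simple i) z) y := by
  obtain ⟨ω', h, rfl⟩ := cs.exists_isReduced y
  rw [← foldl_one cs h, foldr_foldl, star, foldr_foldl]
  have := (cs.exists_isReduced (ω.foldr (fun i z => cs.leftStar (cs.simple i) z) 1)).choose_spec
  rw [foldr_one cs this.1, ← this.2]

theorem star_eq_foldr {ω : List B} (h : cs.IsReduced ω) (y : W) :
    cs.star (cs.wordProd ω) y = ω.foldr (fun i z => cs.leftStar (cs.simple i) z) y := by
  rw [← star_foldr, foldr_one cs h]

theorem star_eq_foldl (x : W) {ω : List B} (h : cs.IsReduced ω) :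
    cs.star x (cs.wordProd ω) = ω.foldl (fun z i => cs.rightStar z (cs.simple i)) x := by
  obtain ⟨ω', h', rfl⟩ := cs.exists_isReduced x
  rw [star_eq_foldr cs h', ← foldl_one cs h, foldr_foldl, foldr_one cs h']

theorem star_one (x : W) : cs.star x 1 = x := by
  simpa using cs.star_eq_foldl x (ω := []) (by simp [IsReduced])

theorem one_star (x : W) : cs.star 1 x = x := by
  simpa using cs.star_eq_foldr (ω := []) (by simp [IsReduced]) x

theorem simple_star (i : B) (x : W) : cs.star (cs.simple i) x = cs.leftStar (cs.simple i) x := by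
  simpa using cs.star_eq_foldr (ω := [i]) (by simp [IsReduced]) x

theorem star_simple (x : W) (i : B) : cs.star x (cs.simple i) = cs.rightStar x (cs.simple i) := by
  simpa using cs.star_eq_foldl x (ω := [i]) (by simp [IsReduced])

theorem star_assoc (x y z : W) : cs.star (cs.star x y) z = cs.star x (cs.star y z) := by
  obtain ⟨ω, h, rfl⟩ := cs.exists_isReduced x
  obtain ⟨ω', h', rfl⟩ := cs.exists_isReduced y
  rw [star_eq_foldr cs h, star_eq_foldr cs h, star_eq_foldr cs h', ← List.foldr_append,
    ← star_foldr cs (ω ++ ω'), List.foldr_append, foldr_one cs h']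

theorem length_foldr_le (ω : List B) (y : W) :
    cs.length (ω.foldr (fun i z => cs.leftStar (cs.simple i) z) y) ≤ ω.length + cs.length y := by
  induction ω with
  | nil => simp
  | cons i ω ih =>
    simp only [List.foldr_cons, List.length_cons]
    set z := ω.foldr (fun i z => cs.leftStar (cs.simple i) z) y
    have := cs.length_simple_mul z i
    unfold leftStar
    split_ifs <;> omega

theorem foldr_eq_of_length (ω : List B) (y : W)
    (h : cs.length (ω.foldr (fun i z => cs.leftStar (cs.simple i) z) y) =
      ω.length + cs.length y) :
    ω.foldr (fun i z => cs.leftStar (cs.simple i) z) y = cs.wordProd ω * y := by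
  induction ω with
  | nil => simp
  | cons i ω ih =>
    simp only [List.foldr_cons, List.length_cons] at h ⊢
    have h1 := cs.length_foldr_le ω y
    set z := ω.foldr (fun i z => cs.leftStar (cs.simple i) z) y
    have := cs.length_simple_mul z i
    unfold leftStar at h ⊢
    split_ifs at h ⊢ with hh
    · rw [ih (by omega), wordProd_cons, mul_assoc]
    · omega

theorem foldr_eq_of_reduced (ω : List B) (y : W)
    (h : cs.length (cs.wordProd ω * y) = ω.length + cs.length y) :
    ω.foldr (fun i z => cs.leftStar (cs.simple i) z) y = cs.wordProd ω * y := by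
  induction ω with
  | nil => simp
  | cons i ω ih =>
    simp only [List.foldr_cons, List.length_cons, wordProd_cons, mul_assoc] at h ⊢
    have h1 := cs.length_mul_le (cs.wordProd ω) y
    have h2 := cs.length_wordProd_le ω
    have := cs.length_simple_mul (cs.wordProd ω * y) i
    rw [ih (by omega), leftStar, if_pos (by omega)]

theorem length_star_le (x y : W) : cs.length (cs.star x y) ≤ cs.length x + cs.length y := by
  obtain ⟨ω, h, rfl⟩ := cs.exists_isReduced x
  rw [star_eq_foldr cs h, h.eq]
  exact cs.length_foldr_le ω y

/-- A star product of maximal length is the product in `W`. -/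
theorem star_eq_mul_of_length_star {x y : W}
    (h : cs.length (cs.star x y) = cs.length x + cs.length y) : cs.star x y = x * y := by
  obtain ⟨ω, hω, rfl⟩ := cs.exists_isReduced x
  rw [star_eq_foldr cs hω, hω.eq] at h
  rw [star_eq_foldr cs hω]
  exact cs.foldr_eq_of_length ω y h

/-- Reduced products in `W` and in the Coxeter monoid agree. -/
theorem star_eq_mul {x y : W}
    (h : cs.length (x * y) = cs.length x + cs.length y) : cs.star x y = x * y := by
  obtain ⟨ω, hω, rfl⟩ := cs.exists_isReduced x
  rw [hω.eq] at h
  rw [star_eq_foldr cs hω]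
  exact cs.foldr_eq_of_reduced ω y h

/-! ### Finitary subsets and longest elements -/

/-- A finitary subset of the set `S` of simple reflections: a subset `I ⊆ S` such that the
parabolic subgroup `W_I` generated by `I` is finite. -/
@[ext]
structure FinitarySubset where
  /-- the underlying set of simple reflections -/
  carrier : Set W
  subset_simple : carrier ⊆ Set.range cs.simple
  finite_parabolic : Finite (Subgroup.closure carrier)

namespace FinitarySubset

variable {cs}

/-- The parabolic subgroup `W_I`. -/
def parabolic (I : cs.FinitarySubset) : Subgroup W := Subgroup.closure I.carrier

theorem exists_longest (I : cs.FinitarySubset) :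
    ∃ w ∈ I.parabolic, ∀ x ∈ I.parabolic, cs.length x ≤ cs.length w := by
  have : Finite I.parabolic := I.finite_parabolic
  obtain ⟨w, hw⟩ := Finite.exists_max (fun x : I.parabolic => cs.length x.1)
  exact ⟨w.1, w.2, fun x hx => hw ⟨x, hx⟩⟩

/-- The longest element `w_I` of `W_I`. -/
noncomputable def longest (I : cs.FinitarySubset) : W := I.exists_longest.choose

theorem longest_mem (I : cs.FinitarySubset) : I.longest ∈ I.parabolic :=
  I.exists_longest.choose_spec.1

theorem length_le_longest (I : cs.FinitarySubset) {x : W} (hx : x ∈ I.parabolic) :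
    cs.length x ≤ cs.length I.longest :=
  I.exists_longest.choose_spec.2 x hx

theorem mem_parabolic (I : cs.FinitarySubset) {s : W} (hs : s ∈ I.carrier) : s ∈ I.parabolic :=
  Subgroup.subset_closure hs

theorem exists_word (I : cs.FinitarySubset) {x : W} (hx : x ∈ I.parabolic) :
    ∃ ω : List B, (∀ i ∈ ω, cs.simple i ∈ I.carrier) ∧ cs.IsReduced ω ∧ cs.wordProd ω = x := by
  suffices h : ∃ ω : List B, (∀ i ∈ ω, cs.simple i ∈ I.carrier) ∧ cs.wordProd ω = x by
    obtain ⟨ω, h1, h2⟩ := h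
    obtain ⟨ω', h3, h4, h5⟩ := cs.exists_reduced_subset ω
    exact ⟨ω', fun i hi => h1 i (h3 hi), h4, h5.trans h2⟩
  refine Subgroup.closure_induction (p := fun x _ => ∃ ω : List B,
    (∀ i ∈ ω, cs.simple i ∈ I.carrier) ∧ cs.wordProd ω = x) ?_ ⟨[], by simp⟩ ?_ ?_ hx
  · intro s hs
    obtain ⟨i, rfl⟩ := I.subset_simple hs
    exact ⟨[i], by simpa using hs, by simp⟩
  · rintro x y _ _ ⟨ω, h1, rfl⟩ ⟨ω', h2, rfl⟩
    refine ⟨ω ++ ω', ?_, by simp [wordProd_append]⟩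
    intro i hi
    rcases List.mem_append.1 hi with hi | hi
    exacts [h1 i hi, h2 i hi]
  · rintro x _ ⟨ω, h1, rfl⟩
    exact ⟨ω.reverse, by simpa using h1, by simp⟩

theorem star_eq_right (I : cs.FinitarySubset) {x u : W} (hx : x ∈ I.parabolic)
    (hu : ∀ s ∈ I.carrier, cs.length (s * u) ≤ cs.length u) : cs.star x u = u := by
  obtain ⟨ω, h1, h2, rfl⟩ := I.exists_word hx
  rw [star_eq_foldr cs h2]
  clear h2 hx
  induction ω with
  | nil => rfl
  | cons i ω ih =>
    rw [List.foldr_cons, ih (fun j hj => h1 j (List.mem_cons_of_mem _ hj)), leftStar, if_neg]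
    exact not_lt.2 (hu _ (h1 i (by simp)))

theorem star_eq_left (I : cs.FinitarySubset) {x u : W} (hx : x ∈ I.parabolic)
    (hu : ∀ s ∈ I.carrier, cs.length (u * s) ≤ cs.length u) : cs.star u x = u := by
  obtain ⟨ω, h1, h2, rfl⟩ := I.exists_word hx
  rw [star_eq_foldl cs _ h2]
  clear h2 hx
  induction ω with
  | nil => rfl
  | cons i ω ih =>
    rw [List.foldl_cons, rightStar, if_neg, ih (fun j hj => h1 j (List.mem_cons_of_mem _ hj))]
    exact not_lt.2 (hu _ (h1 i (by simp)))

theorem longest_star_mul (I : cs.FinitarySubset) {a : W} (ha : a ∈ I.parabolic) (y : W) :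
    cs.star I.longest (a * y) = cs.star I.longest y := by
  refine Subgroup.closure_induction (p := fun a _ => ∀ y,
    cs.star I.longest (a * y) = cs.star I.longest y) ?_ (by simp) ?_ ?_ ha y
  · intro s hs y
    have h0 : cs.star I.longest s = I.longest := I.star_eq_left (I.mem_parabolic hs)
      fun t ht => I.length_le_longest (mul_mem I.longest_mem (I.mem_parabolic ht))
    obtain ⟨i, rfl⟩ := I.subset_simple hs
    have h1 := cs.length_simple_mul y i
    rcases h1 with h1 | h1
    · rw [← h0, star_assoc, star_assoc, simple_star cs i y, leftStar, if_pos (by omega),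
        simple_star, leftStar, if_neg (by simp [h1])]
    · nth_rewrite 2 [← h0]
      rw [star_assoc, simple_star cs i y, leftStar, if_neg (by omega)]
      nth_rewrite 1 [← h0]
      rw [star_assoc, simple_star, leftStar, if_pos (by simp; omega)]
      simp
  · intro a b _ _ h1 h2 y
    rw [mul_assoc, h1, h2]
  · intro a _ h y
    rw [← h (a⁻¹ * y), mul_inv_cancel_left]

theorem star_longest_mul (I : cs.FinitarySubset) {a : W} (ha : a ∈ I.parabolic) (y : W) :
    cs.star (y * a) I.longest = cs.star y I.longest := by
  refine Subgroup.closure_induction (p := fun a _ => ∀ y,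
    cs.star (y * a) I.longest = cs.star y I.longest) ?_ (by simp) ?_ ?_ ha y
  · intro s hs y
    have h0 : cs.star s I.longest = I.longest := I.star_eq_right (I.mem_parabolic hs)
      fun t ht => I.length_le_longest (mul_mem (I.mem_parabolic ht) I.longest_mem)
    obtain ⟨i, rfl⟩ := I.subset_simple hs
    have h1 := cs.length_mul_simple y i
    rcases h1 with h1 | h1
    · rw [← h0, ← star_assoc, ← star_assoc, star_simple cs y i, rightStar, if_pos (by omega),
        star_simple, rightStar, if_neg (by simp [h1])]
    · nth_rewrite 2 [← h0]
      rw [← star_assoc, star_simple cs y i, rightStar, if_neg (by omega)]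
      nth_rewrite 1 [← h0]
      rw [← star_assoc, star_simple, rightStar, if_pos (by simp; omega)]
      simp
  · intro a b _ _ h1 h2 y
    rw [← mul_assoc, h2, h1]
  · intro a _ h y
    rw [← h (y * a⁻¹), inv_mul_cancel_right]

theorem length_mul_longest (I : cs.FinitarySubset) {x u : W} (hu : u ∈ I.parabolic)
    (hu' : ∀ y ∈ I.parabolic, cs.length y ≤ cs.length u)
    (hx : ∀ s ∈ I.carrier, cs.length (x * s) ≤ cs.length x) :
    cs.length (x * u⁻¹) + cs.length u = cs.length x := by
  have : Finite I.parabolic := I.finite_parabolic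
  obtain ⟨v, hv⟩ := Finite.exists_min (fun v : I.parabolic => cs.length (x * v.1))
  set y := x * v.1 with hy
  have hmin : ∀ a ∈ I.parabolic, cs.length y ≤ cs.length (y * a) := fun a ha => by
    rw [hy, mul_assoc]; exact hv ⟨v.1 * a, mul_mem v.2 ha⟩
  have hadd : ∀ a ∈ I.parabolic, cs.length (y * a) = cs.length y + cs.length a := by
    intro a ha
    obtain ⟨ω, h1, h2, rfl⟩ := I.exists_word ha
    clear ha
    induction ω using List.reverseRecOn with
    | nil => simp
    | append_singleton ω i ih =>
      have h2' : cs.IsReduced ω := by simpa using h2.take ω.length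
      have h1' : ∀ j ∈ ω, cs.simple j ∈ I.carrier := fun j hj => h1 j (List.mem_append_left _ hj)
      have ih := ih h1' h2'
      have hωm : ∀ ω' : List B, ω' ⊆ ω → cs.wordProd ω' ∈ I.parabolic := fun ω' hω' => by
        refine list_prod_mem ?_
        intro z hz
        obtain ⟨j, hj, rfl⟩ := List.mem_map.1 hz
        exact I.mem_parabolic (h1' j (hω' hj))
      have hlen := h2.eq
      rw [wordProd_append, wordProd_singleton, List.length_append, List.length_singleton] at hlen
      rw [wordProd_append, wordProd_singleton, ← mul_assoc, hlen]
      have h2e := h2'.eq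
      rcases cs.length_mul_simple (y * cs.wordProd ω) i with h | h
      · omega
      · exfalso
        obtain ⟨τ, hτ, hτy⟩ := cs.exists_isReduced y
        have hτe := hτ.eq
        obtain ⟨k, hk, he⟩ := cs.exchange_right (τ ++ ω) i (by
          rw [wordProd_append, ← hτy]; omega)
        rw [wordProd_append, ← hτy] at he
        rcases lt_or_ge k τ.length with hk' | hk'
        · rw [List.eraseIdx_append_of_lt_length hk', wordProd_append] at he
          have h5 := hmin (cs.wordProd ω * cs.simple i * (cs.wordProd ω)⁻¹)
            (mul_mem (mul_mem (hωm ω (by simp)) (I.mem_parabolic (h1 i (by simp))))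
              (inv_mem (hωm ω (by simp))))
          rw [← mul_assoc, ← mul_assoc, he, mul_inv_cancel_right] at h5
          have h6 := cs.length_wordProd_le (τ.eraseIdx k)
          rw [List.length_eraseIdx_of_lt hk'] at h6
          rw [hτy] at h5
          omega
        · rw [List.eraseIdx_append_of_length_le hk', wordProd_append, ← hτy, mul_assoc,
            mul_right_inj] at he
          have h6 := cs.length_wordProd_le (ω.eraseIdx (k - τ.length))
          rw [List.length_append] at hk
          rw [← he, List.length_eraseIdx_of_lt (by omega)] at h6
          omega
  have hxv : x = y * v.1⁻¹ := by simp [hy]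
  have hvu : v.1⁻¹ = u := by
    have e1 : cs.star v.1⁻¹ u = u := I.star_eq_right (inv_mem v.2)
      fun s hs => hu' _ (mul_mem (I.mem_parabolic hs) hu)
    have e2 : cs.star v.1⁻¹ u = v.1⁻¹ := I.star_eq_left hu fun s hs => by
      have := hx s hs
      rw [hxv, mul_assoc, hadd _ (mul_mem (inv_mem v.2) (I.mem_parabolic hs)),
        hadd _ (inv_mem v.2)] at this
      omega
    rw [← e2, e1]
  rw [hxv, hvu, mul_inv_cancel_right, hadd u hu]

theorem length_longest_mul (I : cs.FinitarySubset) {x : W}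
    (hx : ∀ s ∈ I.carrier, cs.length (s * x) ≤ cs.length x) :
    cs.length (I.longest⁻¹ * x) + cs.length I.longest = cs.length x := by
  have := I.length_mul_longest (x := x⁻¹) (u := I.longest⁻¹) (inv_mem I.longest_mem)
    (fun y hy => by rw [length_inv]; exact I.length_le_longest hy) (fun s hs => by
      obtain ⟨i, rfl⟩ := I.subset_simple hs
      rw [← cs.inv_simple i, ← mul_inv_rev, length_inv, length_inv]
      exact hx _ hs)
  rw [← mul_inv_rev, length_inv, length_inv, length_inv] at this
  exact this

end FinitarySubset

/-! ### Double cosets -/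

variable {cs}

/-- The set `W_I \ W / W_J` of `(I, J)`-cosets. -/
abbrev Coset (I J : cs.FinitarySubset) : Type _ :=
  DoubleCoset.Quotient (I.parabolic : Set W) (J.parabolic : Set W)

namespace Coset

variable {I J K L : cs.FinitarySubset}

/-- The underlying subset of `W` of an `(I, J)`-coset. -/
def elements (p : Coset I J) : Set W := {x | DoubleCoset.mk I.parabolic J.parabolic x = p}

theorem mk_eq_mk {x y : W} :
    DoubleCoset.mk I.parabolic J.parabolic x = DoubleCoset.mk I.parabolic J.parabolic y ↔
      ∃ a ∈ I.parabolic, ∃ b ∈ J.parabolic, y = a * x * b :=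
  Quotient.eq''.trans DoubleCoset.rel_iff

theorem nonempty_elements (p : Coset I J) : p.elements.Nonempty := by
  induction p using Quotient.inductionOn' with
  | h x => exact ⟨x, rfl⟩

theorem finite_elements (p : Coset I J) : p.elements.Finite := by
  obtain ⟨x, rfl⟩ := p.nonempty_elements
  have h1 : (I.parabolic : Set W).Finite := I.finite_parabolic
  have h2 : (J.parabolic : Set W).Finite := J.finite_parabolic
  refine (h1.image2 (fun a b => a * x * b) h2).subset fun y hy => ?_
  obtain ⟨a, ha, b, hb, h⟩ := mk_eq_mk.1 (Eq.symm hy)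
  exact ⟨a, ha, b, hb, h.symm⟩

theorem exists_maxElt (p : Coset I J) :
    ∃ x ∈ p.elements, ∀ y ∈ p.elements, cs.length y ≤ cs.length x :=
  Set.exists_max_image _ cs.length p.finite_elements p.nonempty_elements

theorem exists_minElt (p : Coset I J) :
    ∃ x ∈ p.elements, ∀ y ∈ p.elements, cs.length x ≤ cs.length y :=
  Set.exists_min_image _ cs.length p.finite_elements p.nonempty_elements

/-- The maximal element of a double coset, i.e. its unique element of maximal length. -/
noncomputable def maxElt (p : Coset I J) : W := p.exists_maxElt.choose

/-- The minimal element of a double coset, i.e. its unique element of minimal length. -/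
noncomputable def minElt (p : Coset I J) : W := p.exists_minElt.choose

/-- The left redundancy `I ∩ x J x⁻¹`, where `x` is the minimal element of `p`. -/
def leftRed (p : Coset I J) : Set W :=
  I.carrier ∩ (fun t => p.minElt * t * p.minElt⁻¹) '' J.carrier

/-- The right redundancy `x⁻¹ I x ∩ J`, where `x` is the minimal element of `p`. -/
def rightRed (p : Coset I J) : Set W :=
  (fun s => p.minElt⁻¹ * s * p.minElt) '' I.carrier ∩ J.carrier

/-- Core cosets. -/
def IsCore (p : Coset I J) : Prop := p.leftRed = I.carrier ∧ p.rightRed = J.carrier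

/-- `p` has the reduced expression `[I, K, J]`, where `I ⊆ K ⊇ J`. -/
def HasReducedExpr (p : Coset I J) (K : cs.FinitarySubset) : Prop :=
  I.carrier ⊆ K.carrier ∧ J.carrier ⊆ K.carrier ∧
    p.maxElt = K.longest ∧ cs.length p.maxElt = cs.length K.longest

/-- Atomic cosets: core cosets with a reduced expression `[I + s - t] = [I, K, J]`, where
`K = I ⊔ {s} = J ⊔ {t}`. -/
def IsAtomic (p : Coset I J) : Prop :=
  p.IsCore ∧ ∃ (K : cs.FinitarySubset) (s t : W), s ∉ I.carrier ∧ t ∉ J.carrier ∧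
    K.carrier = insert s I.carrier ∧ K.carrier = insert t J.carrier ∧ p.HasReducedExpr K

/-- The composition `p * q = W_I (p̄ * q̄) W_K` of the singular Coxeter monoid. -/
noncomputable def star (p : Coset I J) (q : Coset J K) : Coset I K :=
  DoubleCoset.mk _ _ (cs.star p.maxElt q.maxElt)

/-- `x . y = z`, i.e. `z = xy` with `ℓ(z) = ℓ(x) + ℓ(y)`. -/
def IsReducedMul (cs : CoxeterSystem M W) (x y z : W) : Prop :=
  x * y = z ∧ cs.length z = cs.length x + cs.length y

/-- The composition `p * q` is reduced: `(p̄ w_J⁻¹) . q̄ = p̄ * q̄ = p̄ . (w_J⁻¹ q̄)`. -/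
def IsReducedComp (p : Coset I J) (q : Coset J K) : Prop :=
  IsReducedMul cs (p.maxElt * J.longest⁻¹) q.maxElt (cs.star p.maxElt q.maxElt) ∧
    IsReducedMul cs p.maxElt (J.longest⁻¹ * q.maxElt) (cs.star p.maxElt q.maxElt)

/-- The identity `(I, I)`-coset. -/
def one (I : cs.FinitarySubset) : Coset I I := DoubleCoset.mk _ _ 1

theorem mk_maxElt (p : Coset I J) : DoubleCoset.mk _ _ p.maxElt = p :=
  p.exists_maxElt.choose_spec.1

theorem length_le_maxElt (p : Coset I J) {x : W} (hx : DoubleCoset.mk _ _ x = p) :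
    cs.length x ≤ cs.length p.maxElt :=
  p.exists_maxElt.choose_spec.2 x hx

theorem maxElt_left (p : Coset I J) {s : W} (hs : s ∈ I.carrier) :
    cs.length (s * p.maxElt) ≤ cs.length p.maxElt := by
  apply p.length_le_maxElt
  conv_rhs => rw [← p.mk_maxElt]
  exact (mk_eq_mk.2 ⟨s, I.mem_parabolic hs, 1, one_mem _, by simp⟩).symm

theorem maxElt_right (p : Coset I J) {s : W} (hs : s ∈ J.carrier) :
    cs.length (p.maxElt * s) ≤ cs.length p.maxElt := by
  apply p.length_le_maxElt
  conv_rhs => rw [← p.mk_maxElt]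
  exact (mk_eq_mk.2 ⟨1, one_mem _, s, J.mem_parabolic hs, by simp⟩).symm

theorem longest_star_maxElt (p : Coset I J) : cs.star I.longest p.maxElt = p.maxElt :=
  I.star_eq_right I.longest_mem fun _ hs => p.maxElt_left hs

theorem maxElt_star_longest (p : Coset I J) : cs.star p.maxElt J.longest = p.maxElt :=
  J.star_eq_left J.longest_mem fun _ hs => p.maxElt_right hs

theorem eq_maxElt {x : W} (p : Coset I J) (hx : DoubleCoset.mk _ _ x = p)
    (h1 : ∀ s ∈ I.carrier, cs.length (s * x) ≤ cs.length x)
    (h2 : ∀ s ∈ J.carrier, cs.length (x * s) ≤ cs.length x) : p.maxElt = x := by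
  obtain ⟨a, ha, b, hb, h⟩ := mk_eq_mk.1 (hx.trans p.mk_maxElt.symm)
  have e1 : cs.star (cs.star I.longest x) J.longest = x := by
    rw [I.star_eq_right I.longest_mem h1, J.star_eq_left J.longest_mem h2]
  have e2 : cs.star (cs.star I.longest p.maxElt) J.longest = p.maxElt := by
    rw [longest_star_maxElt, maxElt_star_longest]
  rw [← e2, h, mul_assoc, I.longest_star_mul ha, star_assoc, J.star_longest_mul hb,
    ← star_assoc, e1]

theorem maxElt_star (p : Coset I J) (q : Coset J K) :
    (p.star q).maxElt = cs.star p.maxElt q.maxElt := by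
  apply eq_maxElt _ rfl
  · intro s hs
    have h : cs.star s p.maxElt = p.maxElt :=
      I.star_eq_right (I.mem_parabolic hs) fun _ ht => p.maxElt_left ht
    obtain ⟨i, rfl⟩ := I.subset_simple hs
    have h' : cs.star (cs.simple i) (cs.star p.maxElt q.maxElt) = cs.star p.maxElt q.maxElt := by
      rw [← star_assoc, h]
    rw [simple_star, leftStar] at h'
    split_ifs at h' with h0
    · rw [h']
    · omega
  · intro s hs
    have h : cs.star q.maxElt s = q.maxElt :=
      K.star_eq_left (K.mem_parabolic hs) fun _ ht => q.maxElt_right ht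
    obtain ⟨i, rfl⟩ := K.subset_simple hs
    have h' : cs.star (cs.star p.maxElt q.maxElt) (cs.simple i) = cs.star p.maxElt q.maxElt := by
      rw [star_assoc, h]
    rw [star_simple, rightStar] at h'
    split_ifs at h' with h0
    · rw [h']
    · omega

theorem maxElt_one (I : cs.FinitarySubset) : (one I).maxElt = I.longest := by
  apply eq_maxElt
  · exact mk_eq_mk.2 ⟨1, one_mem _, I.longest⁻¹, inv_mem I.longest_mem, by simp⟩
  · exact fun s hs => I.length_le_longest (mul_mem (I.mem_parabolic hs) I.longest_mem)
  · exact fun s hs => I.length_le_longest (mul_mem I.longest_mem (I.mem_parabolic hs))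

theorem star_assoc' (p : Coset I J) (q : Coset J K) (r : Coset K L) :
    (p.star q).star r = p.star (q.star r) := by
  rw [star, maxElt_star, star_assoc, ← maxElt_star q r]
  rfl

theorem one_star' (p : Coset I J) : (one I).star p = p := by
  rw [star, maxElt_one, longest_star_maxElt, mk_maxElt]

theorem star_one' (p : Coset I J) : p.star (one J) = p := by
  rw [star, maxElt_one, maxElt_star_longest, mk_maxElt]

theorem length_maxElt_mul (p : Coset I J) :
    cs.length (p.maxElt * J.longest⁻¹) + cs.length J.longest = cs.length p.maxElt :=
  J.length_mul_longest J.longest_mem (fun _ h => J.length_le_longest h)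
    fun _ hs => p.maxElt_right hs

theorem length_mul_maxElt (p : Coset I J) :
    cs.length (I.longest⁻¹ * p.maxElt) + cs.length I.longest = cs.length p.maxElt :=
  I.length_longest_mul fun _ hs => p.maxElt_left hs

theorem star_maxElt_left (p : Coset I J) (q : Coset J K) :
    cs.star (p.maxElt * J.longest⁻¹) q.maxElt = cs.star p.maxElt q.maxElt := by
  have h : cs.star (p.maxElt * J.longest⁻¹) J.longest = p.maxElt := by
    rw [star_eq_mul] <;> rw [inv_mul_cancel_right]
    exact p.length_maxElt_mul.symm
  conv_rhs => rw [← h, star_assoc, q.longest_star_maxElt]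

theorem star_maxElt_right (p : Coset I J) (q : Coset J K) :
    cs.star p.maxElt (J.longest⁻¹ * q.maxElt) = cs.star p.maxElt q.maxElt := by
  have h : cs.star J.longest (J.longest⁻¹ * q.maxElt) = q.maxElt := by
    rw [star_eq_mul] <;> rw [mul_inv_cancel_left]
    rw [add_comm]; exact q.length_mul_maxElt.symm
  conv_rhs => rw [← h, ← star_assoc, p.maxElt_star_longest]

theorem length_star_add_le (p : Coset I J) (q : Coset J K) :
    cs.length (cs.star p.maxElt q.maxElt) + cs.length J.longest ≤
      cs.length p.maxElt + cs.length q.maxElt := by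
  have h1 := cs.length_star_le (p.maxElt * J.longest⁻¹) q.maxElt
  have h2 := p.length_maxElt_mul
  rw [star_maxElt_left] at h1
  omega

theorem isReducedComp_iff (p : Coset I J) (q : Coset J K) :
    p.IsReducedComp q ↔ cs.length (cs.star p.maxElt q.maxElt) + cs.length J.longest =
      cs.length p.maxElt + cs.length q.maxElt := by
  have h2 := p.length_maxElt_mul
  have h3 := q.length_mul_maxElt
  constructor
  · rintro ⟨⟨_, h⟩, _⟩
    omega
  · intro h
    refine ⟨⟨?_, by omega⟩, ⟨?_, by omega⟩⟩
    · rw [← star_maxElt_left, eq_comm]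
      apply star_eq_mul_of_length_star
      rw [star_maxElt_left]; omega
    · rw [← star_maxElt_right, eq_comm]
      apply star_eq_mul_of_length_star
      rw [star_maxElt_right]; omega

theorem isReducedComp_one_left (p : Coset I J) : (one I).IsReducedComp p := by
  rw [isReducedComp_iff, maxElt_one, longest_star_maxElt, add_comm]

theorem isReducedComp_one_right (p : Coset I J) : p.IsReducedComp (one J) := by
  rw [isReducedComp_iff, maxElt_one, maxElt_star_longest]

theorem isReducedComp_assoc (p : Coset I J) (q : Coset J K) (r : Coset K L) :
    p.IsReducedComp q ∧ (p.star q).IsReducedComp r ↔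
      q.IsReducedComp r ∧ p.IsReducedComp (q.star r) := by
  simp only [isReducedComp_iff, maxElt_star, star_assoc]
  have h1 := length_star_add_le p q
  have h2 := length_star_add_le q r
  have h3 := length_star_add_le p (q.star r)
  have h4 := length_star_add_le (p.star q) r
  rw [maxElt_star] at h3 h4
  rw [star_assoc] at h4
  omega

end Coset

/-! ### The nilCoxeter algebroid -/

variable (cs) in
/-- The nilCoxeter algebroid `D(W, S)`. Its objects are the finitary subsets of `S`. -/
def NilCoxeterAlgebroid : Type _ := cs.FinitarySubset

namespace NilCoxeterAlgebroid

open Classical in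
/-- Composition of morphisms, on basis elements: `∂_p ∘ ∂_q` is `∂_{p * q}` if `p * q` is reduced
and `0` otherwise. -/
noncomputable def compBasis {I J K : cs.FinitarySubset} (p : Coset I J) (q : Coset J K) :
    Coset I K →₀ ℤ :=
  if p.IsReducedComp q then Finsupp.single (p.star q) 1 else 0

/-- Composition of morphisms `g ∘ f`, as a bilinear map on free `ℤ`-modules. -/
noncomputable def compLin (I J K : cs.FinitarySubset) :
    (Coset I J →₀ ℤ) →ₗ[ℤ] (Coset J K →₀ ℤ) →ₗ[ℤ] (Coset I K →₀ ℤ) :=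
  Finsupp.linearCombination ℤ fun p => Finsupp.linearCombination ℤ fun q => compBasis p q

theorem compLin_single {I J K : cs.FinitarySubset} (p : Coset I J) (q : Coset J K) :
    compLin I J K (Finsupp.single p 1) (Finsupp.single q 1) = compBasis p q := by
  simp [compLin]

theorem compLin_assoc {I J K L : cs.FinitarySubset} (f : Coset I J →₀ ℤ) (g : Coset J K →₀ ℤ)
    (h : Coset K L →₀ ℤ) :
    compLin I K L (compLin I J K f g) h = compLin I J L f (compLin J K L g h) := by
  induction f using Finsupp.induction_linear with
  | zero => simp
  | add f f' h1 h2 => simp only [map_add, LinearMap.add_apply, h1, h2]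
  | single p a =>
  induction g using Finsupp.induction_linear with
  | zero => simp
  | add f f' h1 h2 => simp only [map_add, LinearMap.add_apply, h1, h2]
  | single q b =>
  induction h using Finsupp.induction_linear with
  | zero => simp
  | add f f' h1 h2 => simp only [map_add, h1, h2]
  | single r c =>
  rw [← mul_one a, ← mul_one b, ← mul_one c, ← smul_eq_mul, ← smul_eq_mul, ← smul_eq_mul,
    ← Finsupp.smul_single, ← Finsupp.smul_single, ← Finsupp.smul_single]
  simp only [map_smul, LinearMap.smul_apply, compLin_single]
  congr 3
  classical
  have e1 : compLin I K L (compBasis p q) (Finsupp.single r 1) =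
      if p.IsReducedComp q ∧ (p.star q).IsReducedComp r then
        Finsupp.single ((p.star q).star r) 1 else 0 := by
    by_cases h1 : p.IsReducedComp q
    · rw [compBasis, if_pos h1, compLin_single, compBasis]; simp [h1]
    · rw [compBasis, if_neg h1]; simp [h1]
  have e2 : compLin I J L (Finsupp.single p 1) (compBasis q r) =
      if q.IsReducedComp r ∧ p.IsReducedComp (q.star r) then
        Finsupp.single (p.star (q.star r)) 1 else 0 := by
    by_cases h1 : q.IsReducedComp r
    · rw [compBasis, if_pos h1, compLin_single, compBasis]; simp [h1]
    · rw [compBasis, if_neg h1]; simp [h1]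
  rw [e1, e2, Coset.star_assoc']
  exact if_congr (Coset.isReducedComp_assoc p q r) rfl rfl

theorem compLin_one_left {I J : cs.FinitarySubset} (f : Coset I J →₀ ℤ) :
    compLin I I J (Finsupp.single (Coset.one I) 1) f = f := by
  induction f using Finsupp.induction_linear with
  | zero => simp
  | add f f' h1 h2 => simp only [map_add, h1, h2]
  | single p a =>
    rw [← mul_one a, ← smul_eq_mul, ← Finsupp.smul_single, map_smul, compLin_single, compBasis,
      if_pos p.isReducedComp_one_left, p.one_star']

theorem compLin_one_right {I J : cs.FinitarySubset} (f : Coset I J →₀ ℤ) :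
    compLin I J J f (Finsupp.single (Coset.one J) 1) = f := by
  induction f using Finsupp.induction_linear with
  | zero => simp
  | add f f' h1 h2 => simp only [map_add, LinearMap.add_apply, h1, h2]
  | single p a =>
    rw [← mul_one a, ← smul_eq_mul, ← Finsupp.smul_single, map_smul, LinearMap.smul_apply,
      compLin_single, compBasis, if_pos p.isReducedComp_one_right, p.star_one']

/-- The morphisms from `J` to `I` form the free `ℤ`-module on the set of `(I, J)`-cosets. -/
noncomputable instance : Category (NilCoxeterAlgebroid cs) where
  Hom J I := Coset (cs := cs) I J →₀ ℤ
  id I := Finsupp.single (Coset.one I) 1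
  comp {K J I} f g := compLin I J K g f
  id_comp f := compLin_one_right f
  comp_id f := compLin_one_left f
  assoc f g h := (compLin_assoc h g f).symm

noncomputable instance : Preadditive (NilCoxeterAlgebroid cs) where
  homGroup J I := inferInstanceAs (AddCommGroup (Coset (cs := cs) I J →₀ ℤ))
  add_comp K J I f f' g := (compLin I J K g).map_add f f'
  comp_add K J I f g g' := LinearMap.congr_fun ((compLin I J K).map_add g g') f

/-- The basis element `∂_p : J ⟶ I` for an `(I, J)`-coset `p`. -/
noncomputable def partialHom {I J : NilCoxeterAlgebroid cs} (p : Coset (cs := cs) I J) : J ⟶ I :=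
  (Finsupp.single p 1 : Coset (cs := cs) I J →₀ ℤ)

open Classical in
/-- The composition rule: `∂_p ∘ ∂_q` is `∂_{p * q}` if `p * q` is reduced, and `0` otherwise. -/
theorem partialHom_comp {I J K : NilCoxeterAlgebroid cs} (p : Coset (cs := cs) I J)
    (q : Coset (cs := cs) J K) :
    partialHom q ≫ partialHom p = if p.IsReducedComp q then partialHom (p.star q) else 0 :=
  compLin_single p q

end NilCoxeterAlgebroid

end CoxeterSystem

/-- A wide `ℤ`-linear subcategory of a `ℤ`-linear category `C`: a subgroup of every group of
morphisms, containing the identities and closed under composition. -/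
structure LinearSubcategory (C : Type*) [Category C] [Preadditive C] where
  /-- the morphisms of the subcategory -/
  hom (X Y : C) : Submodule ℤ (X ⟶ Y)
  id_mem (X : C) : 𝟙 X ∈ hom X X
  comp_mem {X Y Z : C} {f : X ⟶ Y} {g : Y ⟶ Z} : f ∈ hom X Y → g ∈ hom Y Z → f ≫ g ∈ hom X Z

/-- The `ℤ`-linear subcategory (with all objects) generated by a class of morphisms: the
intersection of all those containing the class. -/
def LinearSubcategory.generatedBy {C : Type*} [Category C] [Preadditive C]
    (P : MorphismProperty C) : LinearSubcategory C where
  hom X Y := sInf {N | ∃ A : LinearSubcategory C,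
    (∀ ⦃X Y : C⦄ (f : X ⟶ Y), P f → f ∈ A.hom X Y) ∧ N = A.hom X Y}
  id_mem X := by
    rw [Submodule.mem_sInf]
    rintro _ ⟨A, _, rfl⟩
    exact A.id_mem X
  comp_mem {X Y Z f g} hf hg := by
    rw [Submodule.mem_sInf] at *
    rintro _ ⟨A, hA, rfl⟩
    exact A.comp_mem (hf _ ⟨A, hA, rfl⟩) (hg _ ⟨A, hA, rfl⟩)

namespace CoxeterSystem

variable {B W : Type*} [Group W] {M : CoxeterMatrix B}

/-- The class of the morphisms `∂_p`, for `p` an atomic coset. -/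
def atomicMorphisms (cs : CoxeterSystem M W) : MorphismProperty (NilCoxeterAlgebroid cs) :=
  fun J I f => ∃ p : Coset (cs := cs) I J, p.IsAtomic ∧ f = NilCoxeterAlgebroid.partialHom p

/-- The subcategory `AD(W, S)` of `D(W, S)` generated by the `∂_p` for atomic cosets `p`. -/
noncomputable def atomicSubcategory (cs : CoxeterSystem M W) : LinearSubcategory (NilCoxeterAlgebroid cs) :=
  LinearSubcategory.generatedBy cs.atomicMorphisms

end CoxeterSystem

/-!
A core `(I, J)`-coset is determined by its minimal element `x`, which satisfies `x J x⁻¹ = I` and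
is shortest in `x W_J`; its maximal element is then `x w_J`. The exchange property shows that these
elements are closed under multiplication. The composition of the cosets of `x` and `y` is reduced
exactly if `ℓ(xy) = ℓ(x) + ℓ(y)`, and is then the coset of `xy`, so the `∂_p` for core `p` span a
subcategory.

Conversely, let `x ≠ 1` be such an element and `t` a right descent of `x`. Factor `x = y v` with
`v` in `W_{J ∪ {t}}` and `y` shortest in its coset of this subgroup. For `s ∈ J` the reflection
`v s v⁻¹ = y⁻¹ (x s x⁻¹) y` is conjugate by `y` to a simple reflection, so it has length one and
`L = v J v⁻¹` is a subset of `J ∪ {t}`. A left descent `r` of `v` in `J ∪ {t}` lies outside `L`,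
so `J ∪ {t} = L ∪ {r}` consists of left descents of `v w_J`. This forces `J ∪ {t}` to be finitary
with longest element `v w_J`, so `v` is atomic and `y` is a shorter core element.
-/

open CategoryTheory CoxeterSystem

/-! ### Generated and spanned linear subcategories -/

namespace LinearSubcategory

variable {C : Type*} [Category C] [Preadditive C] {P : MorphismProperty C} {X Y : C}

theorem mem_generatedBy {f : X ⟶ Y} (hf : P f) : f ∈ (generatedBy P).hom X Y := by
  refine Submodule.mem_sInf.2 ?_
  rintro _ ⟨A, hA, rfl⟩
  exact hA f hf

theorem generatedBy_hom_le {A : LinearSubcategory C}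
    (hA : ∀ ⦃X Y : C⦄ (f : X ⟶ Y), P f → f ∈ A.hom X Y) :
    (generatedBy P).hom X Y ≤ A.hom X Y :=
  sInf_le ⟨A, hA, rfl⟩

/-- The linear subcategory whose morphisms are the `ℤ`-linear combinations of morphisms in `P`,
for a class `P` that contains the identities and whose composites are such combinations. -/
def spannedBy (P : MorphismProperty C) [P.ContainsIdentities]
    (hcomp : ∀ ⦃X Y Z : C⦄ (f : X ⟶ Y) (g : Y ⟶ Z), P f → P g →
      f ≫ g ∈ Submodule.span ℤ {h : X ⟶ Z | P h}) : LinearSubcategory C where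
  hom X Y := Submodule.span ℤ {f : X ⟶ Y | P f}
  id_mem X := Submodule.subset_span (P.id_mem X)
  comp_mem {X Y Z _ _} hf hg :=
    LinearMap.BilinMap.apply_apply_mem_of_mem_span _ _ _ (Linear.comp X Y Z)
      (fun f hf g hg => hcomp f g hf hg) _ _ hf hg

end LinearSubcategory

/-! ### Minimal coset representatives and longest elements -/

namespace NilCoxeter

variable {B W : Type*} [Group W] {M : CoxeterMatrix B} {cs : CoxeterSystem M W}

section MinimalRepresentatives

variable {X : Set W} {a y : W}

theorem exists_isReduced_of_mem_closure (hX : X ⊆ Set.range cs.simple)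
    (ha : a ∈ Subgroup.closure X) :
    ∃ ω : List B, (∀ i ∈ ω, cs.simple i ∈ X) ∧ cs.IsReduced ω ∧ cs.wordProd ω = a := by
  rw [← Subgroup.mem_toSubmonoid, Subgroup.closure_toSubmonoid] at ha
  obtain ⟨l, hl, rfl⟩ := Submonoid.exists_list_of_mem_closure ha
  have hlX : ∀ r ∈ l, r ∈ X := fun r hr => (hl r hr).elim id fun hr' => by
    obtain ⟨i, hi⟩ := hX hr'
    rw [← inv_inv r, ← hi, cs.inv_simple, hi]
    exact hr'
  obtain ⟨ω, rfl⟩ : l ∈ Set.range (List.map cs.simple) := by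
    rw [Set.range_list_map]
    exact fun r hr => hX (hlX r hr)
  obtain ⟨ω', hsub, hred, hprod⟩ := cs.exists_reduced_subset ω
  exact ⟨ω', fun i hi => hlX _ (List.mem_map_of_mem (hsub hi)), hred, hprod⟩

theorem mem_of_mem_closure_of_length_eq_one (hX : X ⊆ Set.range cs.simple)
    (ha : a ∈ Subgroup.closure X) (h : cs.length a = 1) : a ∈ X := by
  obtain ⟨ω, hω, hred, rfl⟩ := exists_isReduced_of_mem_closure hX ha
  obtain ⟨i, rfl⟩ := List.length_eq_one_iff.1 (hred.eq.symm.trans h)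
  simpa using hω

theorem exists_mem_length_mul_lt (hX : X ⊆ Set.range cs.simple)
    (ha : a ∈ Subgroup.closure X) (ha1 : a ≠ 1) : ∃ r ∈ X, cs.length (r * a) < cs.length a := by
  obtain ⟨_ | ⟨i, ω⟩, hω, hred, rfl⟩ := exists_isReduced_of_mem_closure hX ha
  · exact absurd cs.wordProd_nil ha1
  · refine ⟨cs.simple i, hω i List.mem_cons_self, ?_⟩
    rw [hred.eq, wordProd_cons, simple_mul_simple_cancel_left, List.length_cons]
    exact Nat.lt_succ_of_le (cs.length_wordProd_le ω)

theorem length_mul_simple_lt_or_length_mul_conj_lt {x y : W} {i : B}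
    (h : cs.length (x * y * cs.simple i) < cs.length (x * y)) :
    cs.length (y * cs.simple i) < cs.length y ∨
      cs.length (x * (y * cs.simple i * y⁻¹)) < cs.length x := by
  obtain ⟨τ, hτ, rfl⟩ := cs.exists_isReduced x
  obtain ⟨ω, hω, rfl⟩ := cs.exists_isReduced y
  rw [← wordProd_append] at h
  obtain ⟨k, hk, he⟩ := cs.exchange_right (τ ++ ω) i h
  rw [hτ.eq, hω.eq]
  rw [List.length_append] at hk
  rcases lt_or_ge k τ.length with hkτ | hkτ
  · right
    rw [List.eraseIdx_append_of_lt_length hkτ, wordProd_append, wordProd_append] at he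
    rw [← mul_assoc, ← mul_assoc, he, mul_inv_cancel_right]
    have := cs.length_wordProd_le (τ.eraseIdx k)
    rw [List.length_eraseIdx_of_lt hkτ] at this
    omega
  · left
    rw [List.eraseIdx_append_of_length_le hkτ, wordProd_append, wordProd_append, mul_assoc,
      mul_right_inj] at he
    have := cs.length_wordProd_le (ω.eraseIdx (k - τ.length))
    rw [← he, List.length_eraseIdx_of_lt (by omega)] at this
    omega

variable (cs) in
/-- `y` has minimal length in its left coset `y H`. Minimal representatives of `W / W_X` arise for
`H = Subgroup.closure X`. -/
def IsMinRep (H : Subgroup W) (y : W) : Prop := ∀ a ∈ H, cs.length y ≤ cs.length (y * a)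

variable (cs) in
theorem exists_isMinRep_mul (H : Subgroup W) (x : W) :
    ∃ y, ∃ a ∈ H, x = y * a ∧ IsMinRep cs H y := by
  obtain ⟨a, ha, hmin⟩ := exists_minimalFor_of_wellFoundedLT (· ∈ H)
    (fun a => cs.length (x * a)) ⟨1, one_mem _⟩
  refine ⟨x * a, a⁻¹, inv_mem ha, (mul_inv_cancel_right _ _).symm, fun b hb => ?_⟩
  rw [mul_assoc]
  exact (le_total _ _).elim id (hmin (mul_mem ha hb))

namespace IsMinRep

theorem mono {H H' : Subgroup W} (hy : IsMinRep cs H' y) (h : H ≤ H') : IsMinRep cs H y :=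
  fun a ha => hy a (h ha)

theorem length_mul (hX : X ⊆ Set.range cs.simple) (hy : IsMinRep cs (Subgroup.closure X) y)
    (ha : a ∈ Subgroup.closure X) : cs.length (y * a) = cs.length y + cs.length a := by
  obtain ⟨ω, hωX, hω, rfl⟩ := exists_isReduced_of_mem_closure hX ha
  clear ha
  induction ω using List.reverseRecOn with
  | nil => simp
  | append_singleton ω i ih =>
    have hω' : cs.IsReduced ω := by simpa using hω.take ω.length
    have hωX' : ∀ j ∈ ω, cs.simple j ∈ X := fun j hj => hωX j (List.mem_append_left _ hj)
    have hωm : cs.wordProd ω ∈ Subgroup.closure X :=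
      list_prod_mem (List.forall_mem_map.2 fun j hj => Subgroup.subset_closure (hωX' j hj))
    have him : cs.simple i ∈ Subgroup.closure X := Subgroup.subset_closure (hωX i (by simp))
    have hlen := hω.eq
    have hlen' := hω'.eq
    rw [wordProd_append, wordProd_singleton, List.length_append, List.length_singleton] at hlen
    rw [wordProd_append, wordProd_singleton, ← mul_assoc, hlen]
    have ih := ih hωX' hω'
    rcases cs.length_mul_simple (y * cs.wordProd ω) i with h | h
    · omega
    · have hlt : cs.length (y * cs.wordProd ω * cs.simple i) < cs.length (y * cs.wordProd ω) := by
        omega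
      rcases length_mul_simple_lt_or_length_mul_conj_lt hlt with h | h
      · omega
      · exact absurd h (hy _ (mul_mem (mul_mem hωm him) (inv_mem hωm))).not_gt

theorem closure_of_forall_mem (hX : X ⊆ Set.range cs.simple)
    (hy : ∀ r ∈ X, cs.length y ≤ cs.length (y * r)) :
    IsMinRep cs (Subgroup.closure X) y := by
  obtain ⟨z, v, hv, rfl, hz⟩ := exists_isMinRep_mul cs (Subgroup.closure X) y
  suffices hv1 : v = 1 by rwa [hv1, mul_one]
  by_contra hv1
  obtain ⟨r, hr, hlt⟩ := exists_mem_length_mul_lt hX (inv_mem hv) (inv_ne_one.2 hv1)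
  obtain ⟨i, rfl⟩ := hX hr
  rw [← cs.inv_simple, ← mul_inv_rev, length_inv, length_inv] at hlt
  have hle := hy _ hr
  rw [mul_assoc, hz.length_mul hX (mul_mem hv (Subgroup.subset_closure hr)),
    hz.length_mul hX hv] at hle
  omega

theorem of_mul {H : Subgroup W} (hX : X ⊆ Set.range cs.simple)
    (hy : IsMinRep cs (Subgroup.closure X) y) (ha : a ∈ Subgroup.closure X)
    (hH : H ≤ Subgroup.closure X) (hya : IsMinRep cs H (y * a)) : IsMinRep cs H a := by
  intro b hb
  have h := hya b hb
  rw [mul_assoc, hy.length_mul hX ha, hy.length_mul hX (mul_mem ha (hH hb))] at h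
  omega

theorem conj_simple_mem (hX : X ⊆ Set.range cs.simple)
    (hy : IsMinRep cs (Subgroup.closure X) y) {i : B}
    (h : y⁻¹ * cs.simple i * y ∈ Subgroup.closure X) : y⁻¹ * cs.simple i * y ∈ X := by
  refine mem_of_mem_closure_of_length_eq_one hX h (le_antisymm ?_ ?_)
  · have hadd := hy.length_mul hX h
    have hle := cs.length_mul_le (cs.simple i) y
    rw [mul_assoc, mul_inv_cancel_left] at hadd
    rw [length_simple] at hle
    rw [mul_assoc]
    omega
  · rw [Nat.one_le_iff_ne_zero, Ne, length_eq_zero_iff, mul_assoc, inv_mul_eq_one, eq_comm,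
      mul_eq_right, ← length_eq_zero_iff, length_simple]
    exact one_ne_zero

theorem length_mul_le_length_mul_longest {J : cs.FinitarySubset} (hy : IsMinRep cs J.parabolic y)
    (ha : a ∈ J.parabolic) : cs.length (y * a) ≤ cs.length (y * J.longest) := by
  rw [hy.length_mul J.subset_simple ha, hy.length_mul J.subset_simple J.longest_mem]
  exact Nat.add_le_add_left (J.length_le_longest ha) _

end IsMinRep

end MinimalRepresentatives

section LongestElement

variable {X : Set W} {a u : W}

variable (cs) in
theorem length_le_length_star (x y : W) : cs.length x ≤ cs.length (cs.star x y) := by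
  obtain ⟨ω, hω, rfl⟩ := cs.exists_isReduced y
  rw [star_eq_foldl cs x hω]
  clear hω
  induction ω generalizing x with
  | nil => rfl
  | cons i ω ih =>
    refine le_trans ?_ (ih _)
    dsimp only [rightStar]
    split_ifs with h
    exacts [h.le, le_rfl]

theorem star_eq_self_of_forall_length_mul_le (hX : X ⊆ Set.range cs.simple)
    (hu : ∀ r ∈ X, cs.length (r * u) ≤ cs.length u) (ha : a ∈ Subgroup.closure X) :
    cs.star a u = u := by
  obtain ⟨ω, hωX, hω, rfl⟩ := exists_isReduced_of_mem_closure hX ha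
  rw [star_eq_foldr cs hω]
  clear hω ha
  induction ω with
  | nil => rfl
  | cons i ω ih =>
    rw [List.foldr_cons, ih (fun j hj => hωX j (List.mem_cons_of_mem _ hj)), leftStar,
      if_neg (hu _ (hωX i List.mem_cons_self)).not_gt]

theorem length_le_of_forall_length_mul_le (hX : X ⊆ Set.range cs.simple)
    (hu : ∀ r ∈ X, cs.length (r * u) ≤ cs.length u) (ha : a ∈ Subgroup.closure X) :
    cs.length a ≤ cs.length u := by
  conv_rhs => rw [← star_eq_self_of_forall_length_mul_le hX hu ha]
  exact length_le_length_star cs a u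

theorem finite_closure_of_length_le (hX : X ⊆ Set.range cs.simple) (hXf : X.Finite) {n : ℕ}
    (h : ∀ a ∈ Subgroup.closure X, cs.length a ≤ n) : Finite (Subgroup.closure X) := by
  have : Finite X := hXf
  refine (((List.finite_length_le X n).image fun l => (l.map Subtype.val).prod).subset
    fun a ha => ?_ : (Subgroup.closure X : Set W).Finite)
  obtain ⟨ω, hωX, hω, rfl⟩ := exists_isReduced_of_mem_closure hX ha
  refine ⟨ω.pmap (fun i hi => ⟨cs.simple i, hi⟩) hωX, ?_, ?_⟩
  · rw [Set.mem_ofPred_eq, List.length_pmap, ← hω.eq]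
    exact h _ ha
  · simp only [List.map_pmap, List.pmap_eq_map]
    rfl

theorem exists_finitarySubset_longest_eq (hX : X ⊆ Set.range cs.simple) (hXf : X.Finite)
    (hu : u ∈ Subgroup.closure X) (hdesc : ∀ r ∈ X, cs.length (r * u) ≤ cs.length u) :
    ∃ K : cs.FinitarySubset, K.carrier = X ∧ K.longest = u := by
  let K : cs.FinitarySubset :=
    ⟨X, hX, finite_closure_of_length_le hX hXf
      fun _ => length_le_of_forall_length_mul_le hX hdesc⟩
  refine ⟨K, rfl, ?_⟩
  have h_star_left : cs.star K.longest u = u := K.star_eq_right K.longest_mem hdesc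
  have h_star_right : cs.star K.longest u = K.longest := K.star_eq_left hu fun r hr =>
    K.length_le_longest (mul_mem K.longest_mem (K.mem_parabolic hr))
  exact h_star_right.symm.trans h_star_left

end LongestElement

/-! ### Core elements -/

variable {I J K : cs.FinitarySubset} {t x y v : W}

/-- The `(I, J)`-coset `W_I x W_J`. -/
abbrev toCoset (I J : cs.FinitarySubset) (x : W) : Coset I J :=
  DoubleCoset.mk I.parabolic J.parabolic x

theorem toCoset_minElt (p : Coset I J) : toCoset I J p.minElt = p :=
  p.exists_minElt.choose_spec.1

theorem length_minElt_toCoset_le (I J : cs.FinitarySubset) (x : W) :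
    cs.length (toCoset I J x).minElt ≤ cs.length x :=
  (toCoset I J x).exists_minElt.choose_spec.2 x rfl

theorem isMinRep_minElt (p : Coset I J) : IsMinRep cs J.parabolic p.minElt := by
  intro a ha
  have hmem : toCoset I J (p.minElt * a) = p := by
    conv_rhs => rw [← toCoset_minElt p]
    exact (Coset.mk_eq_mk.2 ⟨1, one_mem _, a, ha, by rw [one_mul]⟩).symm
  exact p.exists_minElt.choose_spec.2 _ hmem

theorem closure_conj_image (X : Set W) (v : W) : Subgroup.closure (MulAut.conj v '' X) =
    (Subgroup.closure X).map (MulAut.conj v).toMonoidHom := by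
  rw [MonoidHom.map_closure]
  rfl

/-- `x` conjugates `J` to `I` and is shortest in `x W_J`. These are the minimal elements of the
core `(I, J)`-cosets, see `isCore_iff`. -/
structure IsCoreElt (I J : cs.FinitarySubset) (x : W) : Prop where
  image_eq : MulAut.conj x '' J.carrier = I.carrier
  isMinRep : IsMinRep cs J.parabolic x

theorem isCore_iff {p : Coset I J} : p.IsCore ↔ IsCoreElt I J p.minElt := by
  have hrestate : p.IsCore ↔ I.carrier ⊆ MulAut.conj p.minElt '' J.carrier ∧
      J.carrier ⊆ (fun r => p.minElt⁻¹ * r * p.minElt) '' I.carrier :=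
    and_congr Set.inter_eq_left Set.inter_eq_right
  have hconj : J.carrier ⊆ (fun r => p.minElt⁻¹ * r * p.minElt) '' I.carrier ↔
      MulAut.conj p.minElt '' J.carrier ⊆ I.carrier := by
    rw [Set.image_subset_iff, Set.image_eq_preimage_of_inverse (g := MulAut.conj p.minElt)]
    · exact fun _ => by simp [mul_assoc]
    · exact fun _ => by simp [mul_assoc]
  rw [hrestate, hconj]
  exact ⟨fun h => ⟨h.2.antisymm h.1, isMinRep_minElt p⟩,
    fun h => ⟨h.image_eq.ge, h.image_eq.le⟩⟩

theorem exists_isCoreElt_toCoset_eq {p : Coset I J} (hp : p.IsCore) :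
    ∃ x, IsCoreElt I J x ∧ toCoset I J x = p :=
  ⟨p.minElt, isCore_iff.1 hp, toCoset_minElt p⟩

namespace IsCoreElt

theorem one (I : cs.FinitarySubset) : IsCoreElt I I 1 where
  image_eq := by simp
  isMinRep a _ := by simp

theorem eq_of_one (h : IsCoreElt I J 1) : I = J := by
  ext1
  simp [← h.image_eq]

theorem conj_mem (hx : IsCoreElt I J x) {r : W} (hr : r ∈ J.carrier) :
    x * r * x⁻¹ ∈ I.carrier :=
  hx.image_eq ▸ Set.mem_image_of_mem _ hr

theorem inv_conj_mem_parabolic (hx : IsCoreElt I J x) {a : W} (ha : a ∈ I.parabolic) :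
    x⁻¹ * a * x ∈ J.parabolic := by
  rw [FinitarySubset.parabolic, ← hx.image_eq, closure_conj_image] at ha
  obtain ⟨b, hb, rfl⟩ := ha
  simpa [FinitarySubset.parabolic, mul_assoc] using hb

theorem length_mul (hx : IsCoreElt I J x) {a : W} (ha : a ∈ J.parabolic) :
    cs.length (x * a) = cs.length x + cs.length a :=
  hx.isMinRep.length_mul J.subset_simple ha

theorem length_mul_longest (hx : IsCoreElt I J x) :
    cs.length (x * J.longest) = cs.length x + cs.length J.longest :=
  hx.length_mul J.longest_mem

theorem length_mul_mul_longest_le (hx : IsCoreElt I J x) {a : W} (ha : a ∈ I.parabolic) :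
    cs.length (a * (x * J.longest)) ≤ cs.length (x * J.longest) := by
  have hmove : a * (x * J.longest) = x * (x⁻¹ * a * x * J.longest) := by group
  rw [hmove]
  exact hx.isMinRep.length_mul_le_length_mul_longest
    (mul_mem (hx.inv_conj_mem_parabolic ha) J.longest_mem)

theorem mul (hx : IsCoreElt I J x) (hy : IsCoreElt J K y) : IsCoreElt I K (x * y) where
  image_eq := by
    rw [← hx.image_eq, ← hy.image_eq, Set.image_image, map_mul]
    rfl
  isMinRep := by
    refine IsMinRep.closure_of_forall_mem K.subset_simple fun r hr => not_lt.1 fun hlt => ?_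
    obtain ⟨i, rfl⟩ := K.subset_simple hr
    rcases length_mul_simple_lt_or_length_mul_conj_lt hlt with h | h
    · exact (hy.isMinRep _ (K.mem_parabolic hr)).not_gt h
    · exact (hx.isMinRep _ (J.mem_parabolic (hy.conj_mem hr))).not_gt h

theorem toCoset_eq_iff (hx : IsCoreElt I J x) {z : W} :
    toCoset I J z = toCoset I J x ↔ ∃ b ∈ J.parabolic, z = x * b := by
  rw [eq_comm, Coset.mk_eq_mk]
  constructor
  · rintro ⟨a, ha, b, hb, rfl⟩
    exact ⟨x⁻¹ * a * x * b, mul_mem (hx.inv_conj_mem_parabolic ha) hb, by group⟩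
  · rintro ⟨b, hb, rfl⟩
    exact ⟨1, one_mem _, b, hb, by rw [one_mul]⟩

theorem minElt_toCoset (hx : IsCoreElt I J x) : (toCoset I J x).minElt = x := by
  obtain ⟨b, hb, h⟩ := hx.toCoset_eq_iff.1 (toCoset_minElt (toCoset I J x))
  have hle := length_minElt_toCoset_le I J x
  rw [h, hx.length_mul hb] at hle
  rw [h, cs.length_eq_zero_iff.1 (show cs.length b = 0 by omega), mul_one]

theorem maxElt_toCoset (hx : IsCoreElt I J x) : (toCoset I J x).maxElt = x * J.longest := by
  refine Coset.eq_maxElt _ (hx.toCoset_eq_iff.2 ⟨_, J.longest_mem, rfl⟩)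
    (fun r hr => hx.length_mul_mul_longest_le (I.mem_parabolic hr)) fun r hr => ?_
  rw [mul_assoc]
  exact hx.isMinRep.length_mul_le_length_mul_longest
    (mul_mem J.longest_mem (J.mem_parabolic hr))

theorem isCore_toCoset (hx : IsCoreElt I J x) : (toCoset I J x).IsCore := by
  rwa [isCore_iff, hx.minElt_toCoset]

theorem star_maxElt_toCoset (hx : IsCoreElt I J x) (hy : IsCoreElt J K y) :
    cs.star (toCoset I J x).maxElt (toCoset J K y).maxElt = cs.star x (y * K.longest) := by
  rw [← Coset.star_maxElt_left, hx.maxElt_toCoset, hy.maxElt_toCoset, mul_inv_cancel_right]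

theorem star_mul_longest (hx : IsCoreElt I J x) (hy : IsCoreElt J K y)
    (h : cs.length (x * y) = cs.length x + cs.length y) :
    cs.star x (y * K.longest) = x * y * K.longest := by
  rw [mul_assoc]
  apply star_eq_mul
  rw [← mul_assoc, (hx.mul hy).length_mul_longest, hy.length_mul_longest, h, add_assoc]

theorem isReducedComp_toCoset_iff (hx : IsCoreElt I J x) (hy : IsCoreElt J K y) :
    (toCoset I J x).IsReducedComp (toCoset J K y) ↔
      cs.length (x * y) = cs.length x + cs.length y := by
  have hxy := (hx.mul hy).length_mul_longest
  rw [Coset.isReducedComp_iff, hx.star_maxElt_toCoset hy, hx.maxElt_toCoset, hy.maxElt_toCoset,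
    hx.length_mul_longest]
  constructor
  · intro h
    have hstar : cs.star x (y * K.longest) = x * (y * K.longest) :=
      cs.star_eq_mul_of_length_star (by omega)
    rw [hstar, ← mul_assoc, hxy, hy.length_mul_longest] at h
    omega
  · intro h
    rw [hx.star_mul_longest hy h, hxy, hy.length_mul_longest]
    omega

theorem star_toCoset (hx : IsCoreElt I J x) (hy : IsCoreElt J K y)
    (h : cs.length (x * y) = cs.length x + cs.length y) :
    (toCoset I J x).star (toCoset J K y) = toCoset I K (x * y) := by
  rw [Coset.star, hx.star_maxElt_toCoset hy, hx.star_mul_longest hy h]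
  exact (hx.mul hy).toCoset_eq_iff.2 ⟨_, K.longest_mem, rfl⟩

end IsCoreElt

/-! ### Factorization into atomic cosets -/

theorem carrier_finite (I : cs.FinitarySubset) : I.carrier.Finite :=
  (show (I.parabolic : Set W).Finite from I.finite_parabolic).subset Subgroup.subset_closure

/-- The finitary subset `v J v⁻¹`, provided that it consists of simple reflections. -/
def conjFinitary (J : cs.FinitarySubset) (v : W)
    (h : MulAut.conj v '' J.carrier ⊆ Set.range cs.simple) : cs.FinitarySubset where
  carrier := MulAut.conj v '' J.carrier
  subset_simple := h
  finite_parabolic := by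
    rw [closure_conj_image]
    exact (show (J.parabolic : Set W).Finite from J.finite_parabolic).image _

namespace IsCoreElt

theorem notMem_of_length_mul_lt (hx : IsCoreElt I J x) {r : W}
    (h : cs.length (r * x) < cs.length x) : r ∉ I.carrier := by
  intro hr
  have hle := hx.isMinRep _ (hx.inv_conj_mem_parabolic (I.mem_parabolic hr))
  rw [← mul_assoc, mul_inv_cancel_left] at hle
  omega

theorem insert_eq_insert (hx : IsCoreElt I J x) {r : W} (hr : r ∉ I.carrier) (ht : t ∉ J.carrier)
    (hsub : insert r I.carrier ⊆ insert t J.carrier) :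
    insert r I.carrier = insert t J.carrier := by
  have hcard : I.carrier.ncard = J.carrier.ncard := by
    rw [← hx.image_eq, Set.ncard_image_of_injective _ (MulAut.conj x).injective]
  refine Set.eq_of_subset_of_ncard_le hsub ?_ ((carrier_finite J).insert t)
  rw [Set.ncard_insert_of_notMem hr (carrier_finite I),
    Set.ncard_insert_of_notMem ht (carrier_finite J), hcard]

theorem isAtomic_toCoset (hv : IsCoreElt I J v) (ht : t ∈ Set.range cs.simple)
    (htJ : t ∉ J.carrier) (hI : I.carrier ⊆ insert t J.carrier)
    (hvt : v ∈ Subgroup.closure (insert t J.carrier)) (hv1 : v ≠ 1) :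
    (toCoset I J v).IsAtomic := by
  have hX : insert t J.carrier ⊆ Set.range cs.simple := Set.insert_subset ht J.subset_simple
  obtain ⟨r, hr, hlt⟩ := exists_mem_length_mul_lt hX hvt hv1
  have hrI : r ∉ I.carrier := hv.notMem_of_length_mul_lt hlt
  have heq := hv.insert_eq_insert hrI htJ (Set.insert_subset hr hI)
  have hdesc : ∀ q ∈ insert t J.carrier,
      cs.length (q * (v * J.longest)) ≤ cs.length (v * J.longest) := by
    rw [← heq]
    rintro q (rfl | hq)
    · have hle := cs.length_mul_le (q * v) J.longest
      rw [hv.length_mul_longest, ← mul_assoc]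
      omega
    · exact hv.length_mul_mul_longest_le (I.mem_parabolic hq)
  have hmem : v * J.longest ∈ Subgroup.closure (insert t J.carrier) :=
    mul_mem hvt (Subgroup.closure_mono (Set.subset_insert _ _) J.longest_mem)
  obtain ⟨K, hK, hlongest⟩ :=
    exists_finitarySubset_longest_eq hX ((carrier_finite J).insert t) hmem hdesc
  have hmax : (toCoset I J v).maxElt = K.longest := hv.maxElt_toCoset.trans hlongest.symm
  exact ⟨hv.isCore_toCoset, K, r, t, hrI, htJ, hK.trans heq.symm, hK, hK ▸ hI,
    hK ▸ Set.subset_insert _ _, hmax, congrArg _ hmax⟩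

theorem exists_mul_isAtomic (hx : IsCoreElt I J x) (hx1 : x ≠ 1) :
    ∃ (L : cs.FinitarySubset) (y v : W), IsCoreElt I L y ∧ IsCoreElt L J v ∧
      (toCoset L J v).IsAtomic ∧ v ≠ 1 ∧ x = y * v ∧ cs.length x = cs.length y + cs.length v := by
  obtain ⟨i, hi⟩ := cs.exists_rightDescent_of_ne_one hx1
  have hiJ : cs.simple i ∉ J.carrier := fun h => (hx.isMinRep _ (J.mem_parabolic h)).not_gt hi
  have hX : insert (cs.simple i) J.carrier ⊆ Set.range cs.simple :=
    Set.insert_subset ⟨i, rfl⟩ J.subset_simple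
  have hJX : J.parabolic ≤ Subgroup.closure (insert (cs.simple i) J.carrier) :=
    Subgroup.closure_mono (Set.subset_insert _ _)
  obtain ⟨y, v, hv, rfl, hy⟩ :=
    exists_isMinRep_mul cs (Subgroup.closure (insert (cs.simple i) J.carrier)) x
  have hv1 : v ≠ 1 := by
    rintro rfl
    rw [mul_one] at hi
    exact (hy _ (Subgroup.subset_closure (Set.mem_insert _ _))).not_gt hi
  have hL : MulAut.conj v '' J.carrier ⊆ insert (cs.simple i) J.carrier := by
    rintro _ ⟨r, hr, rfl⟩
    obtain ⟨j, hj⟩ := I.subset_simple (hx.conj_mem hr)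
    have hconj : MulAut.conj v r = y⁻¹ * cs.simple j * y := by
      rw [hj, MulAut.conj_apply]
      group
    rw [hconj]
    refine hy.conj_simple_mem hX (hconj ▸ ?_)
    exact mul_mem (mul_mem hv (hJX (J.mem_parabolic hr))) (inv_mem hv)
  let L := conjFinitary J v (hL.trans hX)
  have hvL : IsCoreElt L J v := ⟨rfl, hy.of_mul hX hv hJX hx.isMinRep⟩
  have hyL : IsCoreElt I L y := by
    refine ⟨?_, hy.mono (Subgroup.closure_mono hL)⟩
    rw [← hx.image_eq, ← hvL.image_eq, Set.image_image, map_mul]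
    rfl
  exact ⟨L, y, v, hyL, hvL, hvL.isAtomic_toCoset ⟨i, rfl⟩ hiJ hL hv hv1, hv1, rfl,
    hy.length_mul hX hv⟩

end IsCoreElt

/-! ### The atomic subcategory -/

section AtomicSubcategory

open NilCoxeterAlgebroid

open Classical in
theorem partialHom_toCoset_comp {I J K : NilCoxeterAlgebroid cs}
    (hx : IsCoreElt (cs := cs) I J x) (hy : IsCoreElt (cs := cs) J K y) :
    (partialHom (toCoset (cs := cs) J K y) : K ⟶ J) ≫
        (partialHom (toCoset (cs := cs) I J x) : J ⟶ I) =
      if cs.length (x * y) = cs.length x + cs.length y then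
        partialHom (toCoset (cs := cs) I K (x * y)) else 0 := by
  rw [partialHom_comp]
  refine if_ctx_congr (hx.isReducedComp_toCoset_iff hy) (fun h => ?_) fun _ => rfl
  rw [hx.star_toCoset hy h]

/-- The class of the morphisms `∂_p`, for `p` a core coset. -/
def coreMorphisms (cs : CoxeterSystem M W) : MorphismProperty (NilCoxeterAlgebroid cs) :=
  fun J I f => ∃ p : Coset (cs := cs) I J, p.IsCore ∧ partialHom p = f

instance : (coreMorphisms cs).ContainsIdentities where
  id_mem I := ⟨Coset.one I, (IsCoreElt.one I).isCore_toCoset, rfl⟩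

theorem comp_mem_span_coreMorphisms {I J K : NilCoxeterAlgebroid cs} {f : K ⟶ J} {g : J ⟶ I}
    (hf : coreMorphisms cs f) (hg : coreMorphisms cs g) :
    f ≫ g ∈ Submodule.span ℤ {h : K ⟶ I | coreMorphisms cs h} := by
  classical
  obtain ⟨q, hq, rfl⟩ := hf
  obtain ⟨p, hp, rfl⟩ := hg
  obtain ⟨x, hx, rfl⟩ := exists_isCoreElt_toCoset_eq hp
  obtain ⟨y, hy, rfl⟩ := exists_isCoreElt_toCoset_eq hq
  rw [partialHom_toCoset_comp hx hy]
  split_ifs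
  · exact Submodule.subset_span ⟨_, (hx.mul hy).isCore_toCoset, rfl⟩
  · exact zero_mem _

theorem partialHom_toCoset_mem_atomicSubcategory {I J : NilCoxeterAlgebroid cs}
    (hx : IsCoreElt (cs := cs) I J x) :
    partialHom (toCoset (cs := cs) I J x) ∈ cs.atomicSubcategory.hom J I := by
  classical
  induction hn : cs.length x using Nat.strong_induction_on generalizing J x with
  | _ n ih =>
  by_cases hx1 : x = 1
  · subst hx1
    obtain rfl : I = J := hx.eq_of_one
    exact cs.atomicSubcategory.id_mem I
  · obtain ⟨L, y, v, hy, hv, hatomic, hv1, rfl, hlen⟩ := hx.exists_mul_isAtomic hx1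
    have hcomp := partialHom_toCoset_comp hy hv
    rw [if_pos hlen] at hcomp
    rw [← hcomp]
    have hpos : 0 < cs.length v := Nat.pos_of_ne_zero (mt cs.length_eq_zero_iff.1 hv1)
    exact cs.atomicSubcategory.comp_mem
      (LinearSubcategory.mem_generatedBy ⟨_, hatomic, rfl⟩) (ih _ (by omega) hy rfl)

theorem atomicSubcategory_hom_eq_span (I J : NilCoxeterAlgebroid cs) :
    cs.atomicSubcategory.hom J I = Submodule.span ℤ
      (Set.range fun p : {p : Coset (cs := cs) I J // p.IsCore} => partialHom p.1) := by
  have hrange : (Set.range fun p : {p : Coset (cs := cs) I J // p.IsCore} => partialHom p.1) =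
      {f : J ⟶ I | coreMorphisms cs f} := by
    ext f
    simp [coreMorphisms]
  rw [hrange]
  apply le_antisymm
  · refine LinearSubcategory.generatedBy_hom_le (P := cs.atomicMorphisms)
      (A := .spannedBy (coreMorphisms cs) fun _ _ _ _ _ => comp_mem_span_coreMorphisms) ?_
    rintro J I _ ⟨p, hp, rfl⟩
    exact Submodule.subset_span ⟨p, hp.1, rfl⟩
  · rw [Submodule.span_le]
    rintro _ ⟨p, hp, rfl⟩
    obtain ⟨x, hx, rfl⟩ := exists_isCoreElt_toCoset_eq hp
    exact partialHom_toCoset_mem_atomicSubcategory hx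

-- The identity below is linear from the `ℤ`-module structure that `J ⟶ I` has as a hom group of a
-- preadditive category to the one of finitely supported functions.
theorem linearIndependent_partialHom (I J : NilCoxeterAlgebroid cs) :
    LinearIndependent ℤ fun p : Coset (cs := cs) I J => (partialHom p : J ⟶ I) :=
  LinearIndependent.of_comp
    (AddMonoidHom.toIntLinearMap (AddMonoidHom.id (Coset (cs := cs) I J →₀ ℤ)) :
      (J ⟶ I) →ₗ[ℤ] (Coset (cs := cs) I J →₀ ℤ))
    (Finsupp.linearIndependent_single_one ℤ (Coset (cs := cs) I J))

end AtomicSubcategory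

end NilCoxeter

theorem mainTheorem2 {B W : Type*} [Group W] {M : CoxeterMatrix B} (cs : CoxeterSystem M W)
    (I J : CoxeterSystem.NilCoxeterAlgebroid cs) :
    ∃ b : Module.Basis {p : CoxeterSystem.Coset (cs := cs) I J // p.IsCore} ℤ
        (cs.atomicSubcategory.hom J I),
      ∀ p, (b p : J ⟶ I) = CoxeterSystem.NilCoxeterAlgebroid.partialHom p.1 := by
  have hli := (NilCoxeter.linearIndependent_partialHom I J).comp
    (fun p : {p : CoxeterSystem.Coset (cs := cs) I J // p.IsCore} => p.1) Subtype.val_injective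
  have hspan := NilCoxeter.atomicSubcategory_hom_eq_span I J
  refine ⟨(Module.Basis.span hli).map (LinearEquiv.ofEq _ _ hspan.symm), fun p => ?_⟩
  rw [Module.Basis.map_apply]
  exact congrArg Subtype.val (Module.Basis.span_apply hli p)
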